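/- Let $G$ be a finite connected simple graph with adjacency matrix $A(G)$. An *arithmetical structure* on $G$ is a pair $(\mathbf d,\mathbf r)$ of integer vectors indexed by $V(G)$ such that $\mathbf d$ has nonnegative entries, $\mathbf r$ has positive entries with no nontrivial common factor, and $(\operatorname{diag}(\mathbf d)-A(G))\,\mathbf r=\mathbf 0$. Its *critical group* is the torsion subgroup of $\mathbb Z^{V(G)}/\operatorname{im}(\operatorname{diag}(\mathbf d)-A(G))$. A *subdivision* of a graph is a graph isomorphic to one obtained from it by finitely many (possibly zero) successive edge subdivisions, each of which replaces an edge $xy$ by a path $x,z,y$ through a new vertex $z$. The *number of invariant factors* of a finite abelian group $\mathcal G$ is the number $k$ in its decomposition $\mathcal G\cong\bigoplus_{i=1}^{k}\mathbb Z/\alpha_i\mathbb Z$ with integers $\alpha_i>1$ and $\alpha_1\mid\alpha_2\mid\cdots\mid\alpha_k$. **Corollary.** Let $T$ be a finite tree, and let $\ell(T)$ be its number of leaves (vertices of degree $1$). If $\mathcal G$ is a finite abelian group with at most $\ell(T)-2$ invariant factors, then there are a subdivision $\widetilde T$ of $T$ and an arithmetical structure on $\widetilde T$ whose critical group is isomorphic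 to $\mathcal G$. -/

import Mathlib

universe u v

/-- The subdivision of the edge `s(x, y)` of `G`: the edge is removed, and a new vertex `none` is
added whose neighbours are exactly `x` and `y`. (Meant for `G.Adj x y`.) -/
def SimpleGraph.subdivideEdge {V : Type u} (G : SimpleGraph V) (x y : V) :
    SimpleGraph (Option V) where
  Adj
    | some a, some b => G.Adj a b ∧ s(a, b) ≠ s(x, y)
    | some a, none => a = x ∨ a = y
    | none, some b => b = x ∨ b = y
    | none, none => False
  symm := ⟨by
    rintro (_ | a) (_ | b) h
    · exact h
    · exact h
    · exact h
    · exact ⟨h.1.symm, fun e => h.2 (Sym2.eq_swap.trans e)⟩⟩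
  loopless := ⟨by
    rintro (_ | a) h
    · exact h
    · exact G.loopless.irrefl a h.1⟩

/-- `G.IsSubdivision H`: the graph `H` is, up to isomorphism, obtained from `G` by finitely many
(possibly zero) successive edge subdivisions. -/
inductive SimpleGraph.IsSubdivision {V : Type u} (G : SimpleGraph V) :
    {W : Type u} → SimpleGraph W → Prop
  | of_iso {W : Type u} {H : SimpleGraph W} (e : G ≃g H) : SimpleGraph.IsSubdivision G H
  | subdivide {W X : Type u} {H : SimpleGraph W} {K : SimpleGraph X} {x y : W}
      (h : SimpleGraph.IsSubdivision G H) (hxy : H.Adj x y)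
      (e : H.subdivideEdge x y ≃g K) : SimpleGraph.IsSubdivision G K

/-- The number of leaves (vertices of degree one) of a finite graph. -/
def SimpleGraph.numLeaves {V : Type u} [Fintype V] (G : SimpleGraph V) [DecidableRel G.Adj] : ℕ :=
  (Finset.univ.filter (fun w : V => G.degree w = 1)).card

/-- The generalized Laplacian matrix `diag(d) - A(G)`. -/
def SimpleGraph.genLaplacian {V : Type u} [DecidableEq V] (G : SimpleGraph V)
    [DecidableRel G.Adj] (d : V → ℕ) : Matrix V V ℤ :=
  Matrix.diagonal (fun w => (d w : ℤ)) - G.adjMatrix ℤ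

/-- An arithmetical structure on a finite graph `G`: nonnegative integers `d` and positive integers
`r` without nontrivial common factor, indexed by the vertices, with `(diag(d) - A(G)) r = 0`. -/
structure ArithmeticalStructure {V : Type u} [Fintype V] [DecidableEq V] (G : SimpleGraph V)
    [DecidableRel G.Adj] where
  d : V → ℕ
  r : V → ℕ
  r_pos : ∀ w, 0 < r w
  r_gcd : Finset.univ.gcd r = 1
  laplacian_mulVec : (G.genLaplacian d).mulVec (fun w => (r w : ℤ)) = 0

/-- The critical group of an arithmetical structure: the torsion part of the cokernel
`ℤ^V / im(diag(d) - A(G))` of the generalized Laplacian matrix. -/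
abbrev ArithmeticalStructure.CriticalGroup {V : Type u} [Fintype V] [DecidableEq V]
    {G : SimpleGraph V} [DecidableRel G.Adj] (S : ArithmeticalStructure G) : Type u :=
  Submodule.torsion ℤ ((V → ℤ) ⧸ LinearMap.range (G.genLaplacian S.d).mulVecLin)

/-- The (finite) abelian group `A` has invariant factors `α 0 ∣ α 1 ∣ ⋯ ∣ α (k - 1)`, all greater
than one: `A ≅ ℤ/α 0 ⊕ ⋯ ⊕ ℤ/α (k - 1)`. The number of invariant factors of `A` is `k`. -/
def HasInvariantFactors (A : Type v) [AddCommGroup A] {k : ℕ} (α : Fin k → ℕ) : Prop :=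
  (∀ i, 1 < α i) ∧ (∀ i j, i ≤ j → α i ∣ α j) ∧ Nonempty (A ≃+ ((i : Fin k) → ZMod (α i)))

/-- The abelian group `A` has at most `m` invariant factors, `m` being an integer. -/
def HasAtMostInvariantFactors (A : Type v) [AddCommGroup A] (m : ℤ) : Prop :=
  ∃ (k : ℕ) (α : Fin k → ℕ), (k : ℤ) ≤ m ∧ HasInvariantFactors A α

/-! Leave one leaf `l` with neighbour `w` open: replace the relation d(l) x(l) = x(w) by a x(l) = b
x(w), as if d(l) were the fraction a/b. Three moves act on the relations, on their positive
primitive solution and on the group they present. Raising d(w) by k sends (a, b) to (a, b + ka).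
Lengthening the tree beyond `l` by one vertex, with d(l) = t, sends (a, b) to (b, tb - a). Both only
change variables and keep the group. Hanging at `w` a pendant vertex with d = β, where a = βc, sends
(a, b) to (a, b - c). If a and b are coprime, this multiplies the group by ℤ/β
(`OpenUniversal.pendant`): x(w) is then divisible by a, so the extension splits. Lengthening is also
a subdivision of the last edge, and repeating it as in Euclid's algorithm brings a coprime pair to b
= 1, which is an honest arithmetical structure (`OpenRealizable.realizable`). The pairs with a = M²,
N ∣ M and b ≡ 1 mod M allow any number of pendant vertices with β ∣ N (`Flexible`). The tree is then
built by induction (`realizable_and_flexible`) around a leaf `l` whose neighbour `w` has at most one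
non-leaf neighbour. A further leaf at `w` is removed and hung back with a cyclic factor, at the cost
of at most one leaf. If there is none, removing `l` turns `w` into a leaf and the number of leaves
does not drop. A single edge presents ℤ, so ℓ(T) - 2 factors are available. -/

namespace SimpleGraph

/-! ### Pendant vertices, and the three moves on solutions of the relations. -/

variable {V W : Type*} {C D : Type*} [AddCommGroup C] [AddCommGroup D]

/-- The graph obtained from `G` by attaching a new vertex `none` with the only neighbour `w`. -/
def addPendant (G : SimpleGraph V) (w : V) : SimpleGraph (Option V) where
  Adj
    | some a, some b => G.Adj a b
    | some a, none => a = w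
    | none, some b => b = w
    | none, none => False
  symm := ⟨by
    rintro (_ | a) (_ | b) h
    · exact h
    · exact h
    · exact h
    · exact Adj.symm (G := G) h⟩
  loopless := ⟨by
    rintro (_ | a) h
    · exact h
    · exact G.loopless.irrefl a h⟩

section addPendant

variable (G : SimpleGraph V) (w a b : V)

@[simp] lemma addPendant_some_some : (G.addPendant w).Adj (some a) (some b) ↔ G.Adj a b := Iff.rfl
@[simp] lemma addPendant_some_none : (G.addPendant w).Adj (some a) none ↔ a = w := Iff.rfl
@[simp] lemma addPendant_none_some : (G.addPendant w).Adj none (some b) ↔ b = w := Iff.rfl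
@[simp] lemma addPendant_none_none : ¬ (G.addPendant w).Adj none none := fun h => h

end addPendant

/-- `l` is a leaf of `G`, and `w` is its only neighbour. -/
def IsLeafAt (G : SimpleGraph V) (l w : V) : Prop := ∀ v, G.Adj l v ↔ v = w

lemma IsLeafAt.adj {G : SimpleGraph V} {l w : V} (h : G.IsLeafAt l w) : G.Adj l w := (h w).2 rfl

lemma IsLeafAt.ne {G : SimpleGraph V} {l w : V} (h : G.IsLeafAt l w) : l ≠ w := h.adj.ne

lemma IsLeafAt.adj_iff {G : SimpleGraph V} {l w : V} (h : G.IsLeafAt l w) (v : V) :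
    G.Adj v l ↔ v = w := by
  rw [G.adj_comm]; exact h v

lemma IsLeafAt.addPendant (G : SimpleGraph V) (l : V) : (G.addPendant l).IsLeafAt none (some l) := by
  rintro (_ | v) <;> simp

open Classical in
/-- The sum of `x` over the neighbours of `v`. -/
noncomputable def nbrSum [Fintype V] (G : SimpleGraph V) (x : V → C) (v : V) : C :=
  ∑ w, if G.Adj v w then x w else 0

section nbrSum

variable [Fintype V] [Fintype W] (G : SimpleGraph V)

lemma map_nbrSum (f : C →+ D) (x : V → C) (v : V) :
    f (G.nbrSum x v) = G.nbrSum (fun w => f (x w)) v := by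
  simp only [nbrSum, map_sum, apply_ite f, map_zero]

lemma nbrSum_leaf {l w : V} (h : G.IsLeafAt l w) (x : V → C) : G.nbrSum x l = x w := by
  classical
  have h' : ∀ v, G.Adj l v ↔ v = w := h
  simp [nbrSum, h']

open Classical in
lemma nbrSum_update (x : V → C) (l : V) (c : C) (v : V) :
    G.nbrSum (Function.update x l c) v = G.nbrSum x v + if G.Adj v l then c - x l else 0 := by
  have : ∀ w, (if G.Adj v w then Function.update x l c w else 0) =
      (if G.Adj v w then x w else 0) + if w = l then (if G.Adj v l then c - x l else 0) else 0 := by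
    intro w
    by_cases h : w = l
    · subst h; by_cases h' : G.Adj v w <;> simp [h']
    · simp [h]
  simp only [nbrSum, this, Finset.sum_add_distrib]
  simp

open Classical in
lemma nbrSum_addPendant_some (w : V) (x : Option V → C) (v : V) :
    (G.addPendant w).nbrSum x (some v) =
      G.nbrSum (fun a => x (some a)) v + if v = w then x none else 0 := by
  simp only [nbrSum, Fintype.sum_option, addPendant_some_some, addPendant_some_none]
  rw [add_comm]

end nbrSum

/-- `x` satisfies the relations `d v • x v = ∑ x w` (the sum over the neighbours `w` of `v`) at all
vertices `v` other than `l`, and the relation `a • x l = b • x w`. -/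
structure OpenHarmonic [Fintype V] (G : SimpleGraph V) (d : V → ℤ) (l w : V) (a b : ℤ)
    (x : V → C) : Prop where
  eq_nbrSum : ∀ v, v ≠ l → d v • x v = G.nbrSum x v
  eq_end : a • x l = b • x w

/-- `x` satisfies the relations `d v • x v = ∑ x w` (the sum over the neighbours `w` of `v`) at all
vertices `v`. -/
def Harmonic [Fintype V] (G : SimpleGraph V) (d : V → ℤ) (x : V → C) : Prop :=
  ∀ v, d v • x v = G.nbrSum x v

section harmonic

variable [Fintype V] [Fintype W] {G : SimpleGraph V} {d : V → ℤ} {l w : V} {a b : ℤ}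

lemma OpenHarmonic.map {x : V → C} (h : G.OpenHarmonic d l w a b x) (f : C →+ D) :
    G.OpenHarmonic d l w a b (fun v => f (x v)) where
  eq_nbrSum v hv := by rw [← map_zsmul, h.eq_nbrSum v hv, map_nbrSum]
  eq_end := by rw [← map_zsmul, h.eq_end, map_zsmul]

lemma harmonic_iff_openHarmonic (hl : G.IsLeafAt l w) {x : V → C} :
    G.Harmonic d x ↔ G.OpenHarmonic d l w (d l) 1 x := by
  refine ⟨fun h => ⟨fun v _ => h v, ?_⟩, fun h v => ?_⟩
  · rw [h l, nbrSum_leaf G hl, one_smul]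
  · by_cases hv : v = l
    · subst hv; rw [h.eq_end, nbrSum_leaf G hl, one_smul]
    · exact h.eq_nbrSum v hv

open Classical in
lemma openHarmonic_update_iff {x : V → C} (a' : ℤ) :
    G.OpenHarmonic (Function.update d l a') l w a b x ↔ G.OpenHarmonic d l w a b x := by
  constructor
  · exact fun h => ⟨fun v hv => by simpa [hv] using h.eq_nbrSum v hv, h.eq_end⟩
  · exact fun h => ⟨fun v hv => by simpa [hv] using h.eq_nbrSum v hv, h.eq_end⟩

open Classical in
/-- Increasing `d w` by one means replacing `x l` by `x l + x w`. -/
lemma OpenHarmonic.shift (hl : G.IsLeafAt l w) {x : V → C} (h : G.OpenHarmonic d l w a b x) (k : ℤ) :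
    G.OpenHarmonic (Function.update d w (d w + k)) l w a (b + k * a)
      (Function.update x l (x l + k • x w)) where
  eq_nbrSum v hv := by
    rw [nbrSum_update, Function.update_of_ne hv, ← h.eq_nbrSum v hv]
    by_cases hvw : v = w
    · subst hvw
      simp [hl.adj.symm, add_smul]
    · simp [hl.adj_iff, hvw]
  eq_end := by
    rw [Function.update_self, Function.update_of_ne hl.ne.symm, smul_add, h.eq_end, add_smul,
      smul_smul, mul_comm]

open Classical in
/-- The leaf `l` is turned into a vertex with `d l = t`, by a new leaf attached to it. -/
lemma OpenHarmonic.extend (hl : G.IsLeafAt l w) {x : V → C} (h : G.OpenHarmonic d l w a b x)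
    (t e : ℤ) : (G.addPendant l).OpenHarmonic (fun v => v.elim e (Function.update d l t)) none
      (some l) b (t * b - a) (fun v => v.elim (t • x l - x w) x) where
  eq_nbrSum := by
    rintro (_ | v) hv
    · exact absurd rfl hv
    · rw [nbrSum_addPendant_some]
      by_cases hvl : v = l
      · subst hvl
        simp [nbrSum_leaf G hl]
      · simp [hvl, h.eq_nbrSum v hvl]
  eq_end := by
    simp only [Option.elim]
    rw [smul_sub, ← h.eq_end, smul_smul, sub_smul, mul_comm]

open Classical in
-- The relation at `l`, now closed, forces the value at the new vertex, so `OpenHarmonic.extend`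
-- loses and adds no solutions.
lemma OpenHarmonic.of_extend (hl : G.IsLeafAt l w) {t e : ℤ} {y : Option V → C}
    (h : (G.addPendant l).OpenHarmonic (fun v => v.elim e (Function.update d l t)) none
      (some l) b (t * b - a) y) :
    G.OpenHarmonic d l w a b (fun v => y (some v)) ∧ y none = t • y (some l) - y (some w) := by
  have h1 : t • y (some l) = y (some w) + y none := by
    have := h.eq_nbrSum (some l) (by simp)
    rw [nbrSum_addPendant_some, nbrSum_leaf G hl] at this
    simpa using this
  have h2 : y none = t • y (some l) - y (some w) := by rw [h1]; abel
  refine ⟨⟨fun v hv => ?_, ?_⟩, h2⟩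
  · have := h.eq_nbrSum (some v) (by simp)
    rw [nbrSum_addPendant_some] at this
    simpa [hv] using this
  · have := h.eq_end
    rw [h2, smul_sub, smul_smul, sub_smul, mul_comm, sub_right_inj] at this
    exact this.symm

open Classical in
/-- A new leaf `none` attached to the neighbour `w` of the leaf `l`. -/
lemma OpenHarmonic.pendant (hl : G.IsLeafAt l w) {x : V → C} (h : G.OpenHarmonic d l w a b x)
    {β c : ℤ} (hc : a = β * c) {z : C} (hz : β • z = x w) :
    (G.addPendant w).OpenHarmonic (fun v => v.elim β d) (some l) (some w) a (b - c)
      (fun v => v.elim z (Function.update x l (x l - z))) where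
  eq_nbrSum := by
    rintro (_ | v) hv
    · rw [nbrSum_leaf _ (IsLeafAt.addPendant G w)]
      simp [hl.ne.symm, hz]
    · replace hv : v ≠ l := fun e => hv (by rw [e])
      rw [nbrSum_addPendant_some]
      simp only [Option.elim]
      rw [nbrSum_update, Function.update_of_ne hv, h.eq_nbrSum v hv]
      by_cases hvw : v = w
      · subst hvw; simp [hl.adj.symm]
      · simp [hl.adj_iff, hvw]
  eq_end := by
    simp only [Option.elim, Function.update_self, Function.update_of_ne hl.ne.symm]
    rw [smul_sub, h.eq_end, sub_smul, sub_right_inj, hc, mul_comm, mul_smul, hz]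

open Classical in
-- Solutions after the move are exactly old solutions together with a choice of a β-th part of the
-- value at `w`.
lemma OpenHarmonic.of_pendant (hl : G.IsLeafAt l w) {β c : ℤ} (hc : a = β * c) {y : Option V → C}
    (h : (G.addPendant w).OpenHarmonic (fun v => v.elim β d) (some l) (some w) a (b - c) y) :
    G.OpenHarmonic d l w a b
      (Function.update (fun v => y (some v)) l (y (some l) + y none)) ∧
      β • y none = y (some w) := by
  have hz : β • y none = y (some w) := by
    have := h.eq_nbrSum none (by simp)
    rwa [nbrSum_leaf _ (IsLeafAt.addPendant G w)] at this
  refine ⟨⟨fun v hv => ?_, ?_⟩, hz⟩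
  · have := h.eq_nbrSum (some v) (by simpa using hv)
    rw [nbrSum_addPendant_some] at this
    rw [nbrSum_update, Function.update_of_ne hv]
    simp only [Option.elim] at this
    rw [this]
    by_cases hvw : v = w
    · subst hvw; simp [hl.adj.symm]
    · simp [hl.adj_iff, hvw]
  · have := h.eq_end
    rw [Function.update_self, Function.update_of_ne hl.ne.symm, smul_add, this, sub_smul, hc,
      mul_comm β c, mul_smul, hz]
    abel

end harmonic

end SimpleGraph

/-! ### Subdivisions that keep track of the original vertices. -/

namespace SimpleGraph

/-- `H` is, up to isomorphism, obtained from `G` by successive edge subdivisions, and `φ` is the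
resulting inclusion of the vertices. -/
inductive SubdivisionVia {V : Type u} (G : SimpleGraph V) :
    {W : Type u} → SimpleGraph W → (V → W) → Prop
  | of_iso {W : Type u} {H : SimpleGraph W} (e : G ≃g H) : SubdivisionVia G H e
  | subdivide {W X : Type u} {H : SimpleGraph W} {K : SimpleGraph X} {x y : W} {φ : V → W}
      (h : SubdivisionVia G H φ) (hxy : H.Adj x y) (e : H.subdivideEdge x y ≃g K) :
      SubdivisionVia G K (fun v => e (some (φ v)))

section subdivideEdge

variable {V : Type u} (G : SimpleGraph V) (x y a b : V)

@[simp] lemma subdivideEdge_some_some :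
    (G.subdivideEdge x y).Adj (some a) (some b) ↔ G.Adj a b ∧ s(a, b) ≠ s(x, y) := Iff.rfl
@[simp] lemma subdivideEdge_some_none :
    (G.subdivideEdge x y).Adj (some a) none ↔ a = x ∨ a = y := Iff.rfl
@[simp] lemma subdivideEdge_none_some :
    (G.subdivideEdge x y).Adj none (some b) ↔ b = x ∨ b = y := Iff.rfl
@[simp] lemma subdivideEdge_none_none : ¬ (G.subdivideEdge x y).Adj none none := fun h => h

end subdivideEdge

/-- Isomorphic graphs with a pendant vertex at corresponding vertices. -/
def Iso.addPendant {V W : Type*} {G : SimpleGraph V} {H : SimpleGraph W} (e : G ≃g H) (w : V) :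
    G.addPendant w ≃g H.addPendant (e w) where
  toEquiv := e.toEquiv.optionCongr
  map_rel_iff' := by
    rintro (_ | a) (_ | b) <;> simp [e.map_adj_iff]

/-- Subdividing an edge and attaching a pendant vertex commute. -/
def subdivideEdgeAddPendant {V : Type*} (G : SimpleGraph V) (x y w : V) :
    (G.addPendant w).subdivideEdge (some x) (some y) ≃g
      (G.subdivideEdge x y).addPendant (some w) where
  toFun
    | none => some none
    | some none => none
    | some (some a) => some (some a)
  invFun
    | none => some none
    | some none => none
    | some (some a) => some (some a)
  left_inv := by rintro (_ | _ | a) <;> rfl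
  right_inv := by rintro (_ | _ | a) <;> rfl
  map_rel_iff' := by
    rintro (_ | _ | a) (_ | _ | b) <;> simp

open Classical in
/-- Subdividing the edge at a leaf amounts to attaching a pendant vertex to the leaf. -/
noncomputable def IsLeafAt.isoAddPendant {V : Type*} {G : SimpleGraph V} {l w : V}
    (h : G.IsLeafAt l w) : G.subdivideEdge w l ≃g G.addPendant l where
  toEquiv := Equiv.swap none (some l)
  map_rel_iff' := by
    have key : ∀ v : V, v ≠ l → Equiv.swap none (some l) (some v) = some v := fun v hv =>
      Equiv.swap_apply_of_ne_of_ne (by simp) (by simpa using hv)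
    have hlw := h.ne
    rintro (_ | a) (_ | b)
    · simp
    · by_cases hb : b = l
      · subst hb; simp
      · simp [key b hb, h b, hb]
    · by_cases ha : a = l
      · subst ha; simp
      · simp [key a ha, h.adj_iff a, ha]
    · by_cases ha : a = l <;> by_cases hb : b = l
      · subst ha; subst hb; simp
      · subst ha; simp [key b hb, h b, hb]
      · subst hb; simp [key a ha, h.adj_iff a, ha]
      · simp [key a ha, key b hb, ha, hb]

open Classical in
lemma IsLeafAt.isoAddPendant_apply {V : Type*} {G : SimpleGraph V} {l w : V}
    (h : G.IsLeafAt l w) : h.isoAddPendant (some l) = none :=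
  Equiv.swap_apply_right (none : Option V) (some l)

namespace SubdivisionVia

variable {V U W : Type u} {G : SimpleGraph V} {H : SimpleGraph W} {φ : V → W}

lemma isSubdivision (h : G.SubdivisionVia H φ) : G.IsSubdivision H := by
  induction h with
  | of_iso e => exact .of_iso e
  | subdivide _ hxy e ih => exact .subdivide ih hxy e

lemma comp_iso (h : G.SubdivisionVia H φ) {F : SimpleGraph U} (e : F ≃g G) :
    F.SubdivisionVia H (fun v => φ (e v)) := by
  induction h with
  | of_iso e' => exact .of_iso (e.trans e')
  | subdivide _ hxy e' ih => exact .subdivide ih hxy e'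

/-- Subdividing never changes the degree of an old vertex; only the neighbour of the leaf may become
a new vertex. -/
lemma exists_isLeafAt (h : G.SubdivisionVia H φ) {l w : V} (hl : G.IsLeafAt l w) :
    ∃ w', H.IsLeafAt (φ l) w' := by
  induction h with
  | of_iso e =>
    refine ⟨e w, fun v => ?_⟩
    obtain ⟨v, rfl⟩ := e.surjective v
    rw [e.map_adj_iff, hl v, e.injective.eq_iff]
  | @subdivide W X H K x y φ h hxy e ih =>
    obtain ⟨w', hw'⟩ := ih
    suffices ∃ w'', (H.subdivideEdge x y).IsLeafAt (some (φ l)) w'' by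
      obtain ⟨w'', hw''⟩ := this
      refine ⟨e w'', fun v => ?_⟩
      obtain ⟨v, rfl⟩ := e.surjective v
      rw [e.map_adj_iff, hw'' v, e.injective.eq_iff]
    have hadj := hw'.adj
    have hne := hw'.ne
    by_cases hx : x = φ l
    · refine ⟨none, ?_⟩
      rintro (_ | v)
      · simp [hx]
      · have := (hw' y).1 (hx ▸ hxy)
        simp [hw' v, hx, this]
        grind
    by_cases hy : y = φ l
    · refine ⟨none, ?_⟩
      rintro (_ | v)
      · simp [hy]
      · have := (hw' x).1 (hy ▸ hxy.symm)
        simp [hw' v, hy, this]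
        grind
    · refine ⟨some w', ?_⟩
      rintro (_ | v)
      · simp [Ne.symm hx, Ne.symm hy]
      · simp [hw' v]
        grind

lemma addPendant (h : G.SubdivisionVia H φ) (w : V) :
    (G.addPendant w).SubdivisionVia (H.addPendant (φ w)) (Option.map φ) := by
  induction h with
  | of_iso e => exact .of_iso (e.addPendant w)
  | @subdivide W X H K x y φ h hxy e ih =>
    have := SubdivisionVia.subdivide (x := some x) (y := some y) ih hxy
      ((H.subdivideEdgeAddPendant x y (φ w)).trans (e.addPendant (some (φ w))))
    convert this using 1
    funext v
    cases v <;> rfl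

/-- The inclusion is moved so that `l` goes to the new end and its former image counts as the
subdividing vertex. -/
lemma extend (h : G.SubdivisionVia H φ) {l : V} {w : W} (hl : H.IsLeafAt (φ l) w) :
    ∃ ψ : V → Option W, G.SubdivisionVia (H.addPendant (φ l)) ψ ∧ ψ l = none := by
  refine ⟨_, .subdivide h hl.adj.symm hl.isoAddPendant, ?_⟩
  exact hl.isoAddPendant_apply

end SubdivisionVia

/-! ### Groups presented by the relations; generation replaces uniqueness of the lift. -/

variable {V : Type u} [Fintype V]

/-- The group `C` is generated by the family `x` subject to the relations of `OpenHarmonic`. -/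
structure OpenUniversal (G : SimpleGraph V) (d : V → ℤ) (l w : V) (a b : ℤ) {C : Type}
    [AddCommGroup C] (x : V → C) : Prop where
  harmonic : G.OpenHarmonic d l w a b x
  closure_eq : AddSubgroup.closure (Set.range x) = ⊤
  lift : ∀ (D : Type u) [AddCommGroup D] (y : V → D), G.OpenHarmonic d l w a b y →
    ∃ f : C →+ D, ∀ v, f (x v) = y v

/-- The group `C` is generated by the family `x` subject to the relations of `Harmonic`. -/
structure Universal (G : SimpleGraph V) (d : V → ℤ) {C : Type}
    [AddCommGroup C] (x : V → C) : Prop where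
  harmonic : G.Harmonic d x
  closure_eq : AddSubgroup.closure (Set.range x) = ⊤
  lift : ∀ (D : Type u) [AddCommGroup D] (y : V → D), G.Harmonic d y →
    ∃ f : C →+ D, ∀ v, f (x v) = y v

lemma universal_iff_openUniversal {G : SimpleGraph V} {d : V → ℤ} {l w : V} {C : Type}
    [AddCommGroup C] {x : V → C} (hl : G.IsLeafAt l w) :
    G.Universal d x ↔ G.OpenUniversal d l w (d l) 1 x :=
  ⟨fun h => ⟨(harmonic_iff_openHarmonic hl).1 h.harmonic, h.closure_eq, fun D _ y hy =>
      h.lift D y ((harmonic_iff_openHarmonic hl).2 hy)⟩,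
    fun h => ⟨(harmonic_iff_openHarmonic hl).2 h.harmonic, h.closure_eq, fun D _ y hy =>
      h.lift D y ((harmonic_iff_openHarmonic hl).1 hy)⟩⟩

namespace OpenUniversal

variable {G : SimpleGraph V} {d : V → ℤ} {l w : V} {a b : ℤ} {C : Type} [AddCommGroup C] {x : V → C}

lemma congr_equiv (h : G.OpenUniversal d l w a b x) {C' : Type} [AddCommGroup C'] (e : C ≃+ C') :
    G.OpenUniversal d l w a b (fun v => e (x v)) where
  harmonic := h.harmonic.map e.toAddMonoidHom
  closure_eq := by
    have : Set.range (fun v => e (x v)) = (e : C →+ C') '' Set.range x := by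
      ext; simp
    rw [this, ← AddMonoidHom.map_closure, h.closure_eq, ← AddMonoidHom.range_eq_map,
      AddMonoidHom.range_eq_top]
    exact e.surjective
  lift D _ y hy := by
    obtain ⟨f, hf⟩ := h.lift D y hy
    exact ⟨f.comp e.symm.toAddMonoidHom, fun v => by simp [hf]⟩

open Classical in
lemma update_end (h : G.OpenUniversal d l w a b x) (c : ℤ) :
    G.OpenUniversal (Function.update d l c) l w a b x :=
  ⟨(openHarmonic_update_iff c).2 h.harmonic, h.closure_eq, fun D _ y hy =>
    h.lift D y ((openHarmonic_update_iff c).1 hy)⟩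

open Classical in
lemma shift (hl : G.IsLeafAt l w) (h : G.OpenUniversal d l w a b x) (k : ℤ) :
    G.OpenUniversal (Function.update d w (d w + k)) l w a (b + k * a)
      (Function.update x l (x l + k • x w)) where
  harmonic := h.harmonic.shift hl k
  closure_eq := by
    rw [eq_top_iff, ← h.closure_eq, AddSubgroup.closure_le]
    rintro _ ⟨v, rfl⟩
    have key : ∀ u, u ≠ l → x u ∈ AddSubgroup.closure
        (Set.range (Function.update x l (x l + k • x w))) := fun u hu =>
      AddSubgroup.subset_closure ⟨u, Function.update_of_ne hu _ _⟩
    by_cases hv : v = l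
    · subst hv
      have h1 : x v + k • x w ∈ AddSubgroup.closure
          (Set.range (Function.update x v (x v + k • x w))) :=
        AddSubgroup.subset_closure ⟨v, Function.update_self _ _ _⟩
      have := sub_mem h1 (zsmul_mem (key w hl.ne.symm) k)
      rwa [add_sub_cancel_right] at this
    · exact key v hv
  lift D _ y hy := by
    -- The change of variables is undone by the shift by `-k`.
    have := hy.shift hl (-k)
    rw [Function.update_idem, Function.update_self,
      show b + k * a + -k * a = b by ring, show d w + k + -k = d w by ring,
      Function.update_eq_self] at this
    obtain ⟨f, hf⟩ := h.lift D _ this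
    refine ⟨f, fun v => ?_⟩
    by_cases hv : v = l
    · subst hv
      simp [hf, hl.ne.symm]
    · simp [hv, hf]

open Classical in
lemma extend (hl : G.IsLeafAt l w) (h : G.OpenUniversal d l w a b x) (t e : ℤ) :
    (G.addPendant l).OpenUniversal (fun v => v.elim e (Function.update d l t)) none
      (some l) b (t * b - a) (fun v => v.elim (t • x l - x w) x) where
  harmonic := h.harmonic.extend hl t e
  closure_eq := by
    rw [eq_top_iff, ← h.closure_eq]
    refine AddSubgroup.closure_mono ?_
    rintro _ ⟨v, rfl⟩
    exact ⟨some v, rfl⟩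
  lift D _ y hy := by
    obtain ⟨h1, h2⟩ := hy.of_extend hl
    obtain ⟨f, hf⟩ := h.lift D _ h1
    refine ⟨f, ?_⟩
    rintro (_ | v)
    · simp [hf, h2]
    · exact hf v

open Classical in
-- The new group adjoins to `C` an element z with βz = x(w). From pa + qb = 1 one gets x(w) = aE
-- with E = p x(w) + q x(l), so z - cE has order dividing β and splits off a factor ℤ/β.
lemma pendant (hl : G.IsLeafAt l w) (h : G.OpenUniversal d l w a b x) {β : ℕ} {c : ℤ}
    (hc : a = β * c) (hab : IsCoprime a b) :
    ∃ x' : Option V → C × ZMod β,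
      (G.addPendant w).OpenUniversal (fun v => v.elim (β : ℤ) d) (some l) (some w) a (b - c) x' := by
  obtain ⟨p, q, hpq⟩ := hab
  have hE : ∀ {D : Type u} [AddCommGroup D] {y : V → D}, G.OpenHarmonic d l w a b y →
      a • (p • y w + q • y l) = y w := by
    intro D _ y hy
    calc a • (p • y w + q • y l) = (p * a) • y w + q • (a • y l) := by module
      _ = (p * a + q * b) • y w := by rw [hy.eq_end]; module
      _ = y w := by rw [hpq, one_smul]
  have hE' : a • (p • x w + q • x l) = x w := by
    calc a • (p • x w + q • x l) = (p * a) • x w + q • (a • x l) := by module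
      _ = (p * a + q * b) • x w := by rw [h.harmonic.eq_end]; module
      _ = x w := by rw [hpq, one_smul]
  set E := p • x w + q • x l with hEdef
  set X : V → C × ZMod β := fun v => (x v, 0) with hX
  set z : C × ZMod β := (c • E, 1) with hz
  have hzβ : (β : ℤ) • z = X w := by
    simp only [hz, hX, Prod.smul_mk, Prod.mk.injEq]
    refine ⟨?_, by simp⟩
    rw [smul_smul, ← hc, hE']
  refine ⟨_, OpenHarmonic.pendant hl (x := X) (h.harmonic.map (AddMonoidHom.inl C (ZMod β))) hc hzβ,
    ?_, ?_⟩
  · set S := AddSubgroup.closure (Set.range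
      (fun v : Option V => v.elim z (Function.update X l (X l - z)))) with hS
    have hzS : z ∈ S := AddSubgroup.subset_closure ⟨none, rfl⟩
    have hXS : ∀ v, X v ∈ S := by
      intro v
      by_cases hv : v = l
      · subst hv
        have : X v - z ∈ S := AddSubgroup.subset_closure ⟨some v, by simp⟩
        simpa using add_mem this hzS
      · exact AddSubgroup.subset_closure ⟨some v, by simp [hv]⟩
    have hC : ∀ g : C, ((g, 0) : C × ZMod β) ∈ S := by
      intro g
      have : g ∈ AddSubgroup.closure (Set.range x) := by rw [h.closure_eq]; trivial
      have hle : AddSubgroup.closure (Set.range x) ≤ S.comap (AddMonoidHom.inl C (ZMod β)) := by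
        rw [AddSubgroup.closure_le]
        rintro _ ⟨v, rfl⟩
        exact hXS v
      exact hle this
    rw [eq_top_iff]
    rintro ⟨g, m⟩ -
    have h1 : ((0, 1) : C × ZMod β) ∈ S := by
      have := sub_mem hzS (hC (c • E))
      simpa [hz] using this
    obtain ⟨k, rfl⟩ := ZMod.intCast_surjective m
    have := add_mem (hC g) (zsmul_mem h1 k)
    simpa using this
  · intro D _ y hy
    obtain ⟨h1, h2⟩ := hy.of_pendant hl hc
    obtain ⟨f, hf⟩ := h.lift D _ h1
    have hfE : (β : ℤ) • (y none - c • f E) = 0 := by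
      rw [smul_sub, smul_smul, ← hc, h2, ← map_zsmul, hE', hf, Function.update_of_ne hl.ne.symm,
        sub_self]
    -- The generator of the cyclic factor is z - cE, which prescribes its image.
    let g : ZMod β →+ D := ZMod.lift β ⟨zmultiplesHom D (y none - c • f E), by simpa using hfE⟩
    have hg : g 1 = y none - c • f E := by
      have := ZMod.lift_coe β ⟨zmultiplesHom D (y none - c • f E), by simpa using hfE⟩ 1
      simpa [g] using this
    refine ⟨f.coprod g, ?_⟩
    have hzf : f.coprod g z = y none := by
      simp [hz, hg]
    rintro (_ | v)
    · exact hzf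
    · by_cases hv : v = l
      · subst hv
        simp only [Option.elim, Function.update_self, map_sub, hzf]
        simp [hX, hf]
      · simp [hX, hf, hv]

end OpenUniversal

end SimpleGraph

/-! ### The moves on positive primitive solutions, and the arithmetic of the pairs (a, b). -/

namespace SimpleGraph

variable {V : Type u}

/-- A positive primitive integer solution `r` of the relations of `OpenHarmonic` at a leaf `l`,
together with a family `x` presenting the group `C` by these relations. -/
structure OpenState [Fintype V] (G : SimpleGraph V) (d : V → ℤ) (l w : V) (a b : ℤ)
    (r : V → ℤ) {C : Type} [AddCommGroup C] (x : V → C) : Prop where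
  leaf : G.IsLeafAt l w
  pos : ∀ v, 0 < r v
  primitive : ∀ g : ℤ, (∀ v, g ∣ r v) → IsUnit g
  harmonic : G.OpenHarmonic d l w a b r
  universal : G.OpenUniversal d l w a b x

namespace OpenState

variable [Fintype V] {G : SimpleGraph V} {d : V → ℤ} {l w : V} {a b : ℤ} {r : V → ℤ} {C : Type}
  [AddCommGroup C] {x : V → C}

lemma shift (h : G.OpenState d l w a b r x) {k : ℤ} (hk : 0 ≤ k) :
    ∃ (d' r' : V → ℤ) (x' : V → C), G.OpenState d' l w a (b + k * a) r' x' := by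
  classical
  refine ⟨_, _, _, h.leaf, fun v => ?_, fun g hg => h.primitive g fun v => ?_,
    h.harmonic.shift h.leaf k, h.universal.shift h.leaf k⟩
  · by_cases hv : v = l
    · subst hv
      have := mul_nonneg hk (h.pos w).le
      simpa using add_pos_of_pos_of_nonneg (h.pos v) this
    · simpa [hv] using h.pos v
  · by_cases hv : v = l
    · subst hv
      have h1 := hg v
      have h2 := hg w
      rw [Function.update_self] at h1
      rw [Function.update_of_ne h.leaf.ne.symm] at h2
      exact (dvd_add_left (h2.mul_left k)).1 h1
    · simpa [hv] using hg v

lemma extend (h : G.OpenState d l w a b r x) (hb : 0 < b) {t : ℤ} (ht : 0 < t * b - a) :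
    ∃ (d' r' : Option V → ℤ) (x' : Option V → C),
      (G.addPendant l).OpenState d' none (some l) b (t * b - a) r' x' := by
  classical
  have hr := h.harmonic.extend h.leaf t 0
  refine ⟨_, _, _, IsLeafAt.addPendant G l, ?_, fun g hg => h.primitive g fun v => hg (some v),
    hr, h.universal.extend h.leaf t 0⟩
  rintro (_ | v)
  · have := hr.eq_end
    simp only [smul_eq_mul, Option.elim] at this ⊢
    have h2 := mul_pos ht (h.pos l)
    rw [← this] at h2
    exact pos_of_mul_pos_right h2 hb.le
  · exact h.pos v

/-- Coprimality gives a ∣ r(w), so the value r(w)/β at the new vertex is an integer; b - c > 0 keeps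
the value at `l` positive. -/
lemma pendant (h : G.OpenState d l w a b r x) (ha : 0 < a) (hab : IsCoprime a b) {β : ℕ} {c : ℤ}
    (hc : a = β * c) (hb : 0 < b - c) :
    ∃ (d' r' : Option V → ℤ) (x' : Option V → C × ZMod β),
      (G.addPendant w).OpenState d' (some l) (some w) a (b - c) r' x' := by
  classical
  obtain ⟨x', hx'⟩ := h.universal.pendant h.leaf hc hab
  have hdvd : a ∣ r w := hab.dvd_of_dvd_mul_left ⟨r l, by simpa using h.harmonic.eq_end.symm⟩
  obtain ⟨e, he⟩ := hdvd
  have hz : (β : ℤ) • (c * e) = r w := by rw [he, hc, smul_eq_mul, mul_assoc]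
  have hβ : 0 < (β : ℤ) := by
    rcases Nat.eq_zero_or_pos β with rfl | h0
    · simp at hc; omega
    · exact_mod_cast h0
  have hr := h.harmonic.pendant h.leaf hc hz
  refine ⟨_, _, x', ?_, ?_, ?_, hr, hx'⟩
  · rintro (_ | v)
    · simpa using h.leaf.ne
    · simpa using h.leaf v
  · rintro (_ | v)
    · have : 0 < (β : ℤ) * (c * e) := by
        have := h.pos w
        rwa [← hz, smul_eq_mul] at this
      exact pos_of_mul_pos_right this hβ.le
    · by_cases hv : v = l
      · subst hv
        have := hr.eq_end
        simp only [Option.elim, smul_eq_mul, Function.update_self,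
          Function.update_of_ne h.leaf.ne.symm] at this ⊢
        have h2 := mul_pos hb (h.pos w)
        rw [← this] at h2
        exact pos_of_mul_pos_right h2 ha.le
      · simpa [hv] using h.pos v
  · refine fun g hg => h.primitive g fun v => ?_
    by_cases hv : v = l
    · subst hv
      have h1 := hg (some v)
      have h2 := hg none
      simp only [Option.elim, Function.update_self] at h1 h2
      exact (dvd_sub_left h2).1 h1
    · simpa [hv] using hg (some v)

lemma congr_equiv (h : G.OpenState d l w a b r x) {C' : Type} [AddCommGroup C'] (e : C ≃+ C') :
    G.OpenState d l w a b r (fun v => e (x v)) :=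
  ⟨h.leaf, h.pos, h.primitive, h.harmonic, h.universal.congr_equiv e⟩

end OpenState

/-- A subdivision of `T` carries an arithmetical structure the cokernel of which is `C`. -/
def Realizable (T : SimpleGraph V) (C : Type) [AddCommGroup C] : Prop :=
  ∃ (W : Type u) (_ : Fintype W) (H : SimpleGraph W) (φ : V → W) (d r : W → ℤ) (x : W → C),
    T.SubdivisionVia H φ ∧ (∀ v, 0 < r v) ∧ (∀ g : ℤ, (∀ v, g ∣ r v) → IsUnit g) ∧
      H.Harmonic d r ∧ H.Universal d x

/-- A subdivision of `T` carries an `OpenState` at the leaf `l` presenting `C`. -/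
def OpenRealizable (T : SimpleGraph V) (l : V) (C : Type) [AddCommGroup C] (a b : ℤ) : Prop :=
  ∃ (W : Type u) (_ : Fintype W) (H : SimpleGraph W) (φ : V → W) (w : W) (d r : W → ℤ) (x : W → C),
    T.SubdivisionVia H φ ∧ H.OpenState d (φ l) w a b r x

/-- A subdivision of `T` in which the edge `l w` is retained carries an `OpenState` at the leaf `l`
presenting `C`. -/
def OpenRealizableAt (T : SimpleGraph V) (l w : V) (C : Type) [AddCommGroup C] (a b : ℤ) : Prop :=
  ∃ (W : Type u) (_ : Fintype W) (H : SimpleGraph W) (φ : V → W) (d r : W → ℤ) (x : W → C),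
    T.SubdivisionVia H φ ∧ H.OpenState d (φ l) (φ w) a b r x

section realizable

variable {T : SimpleGraph V} {l w : V} {C : Type} [AddCommGroup C] {a b : ℤ}

lemma OpenRealizable.shift (h : T.OpenRealizable l C a b) {k : ℤ} (hk : 0 ≤ k) :
    T.OpenRealizable l C a (b + k * a) := by
  obtain ⟨W, _, H, φ, w, d, r, x, hφ, h⟩ := h
  obtain ⟨d', r', x', h'⟩ := h.shift hk
  exact ⟨W, _, H, φ, w, d', r', x', hφ, h'⟩

lemma OpenRealizableAt.shift (h : T.OpenRealizableAt l w C a b) {k : ℤ} (hk : 0 ≤ k) :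
    T.OpenRealizableAt l w C a (b + k * a) := by
  obtain ⟨W, _, H, φ, d, r, x, hφ, h⟩ := h
  obtain ⟨d', r', x', h'⟩ := h.shift hk
  exact ⟨W, _, H, φ, d', r', x', hφ, h'⟩

lemma OpenRealizableAt.openRealizable (h : T.OpenRealizableAt l w C a b) :
    T.OpenRealizable l C a b := by
  obtain ⟨W, _, H, φ, d, r, x, hφ, h⟩ := h
  exact ⟨W, _, H, φ, φ w, d, r, x, hφ, h⟩

lemma OpenRealizableAt.congr_equiv (h : T.OpenRealizableAt l w C a b) {C' : Type}
    [AddCommGroup C'] (e : C ≃+ C') : T.OpenRealizableAt l w C' a b := by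
  obtain ⟨W, _, H, φ, d, r, x, hφ, h⟩ := h
  exact ⟨W, _, H, φ, d, r, _, hφ, h.congr_equiv e⟩

lemma OpenRealizableAt.comp_iso {U : Type u} {F : SimpleGraph U} (e : F ≃g T) {l w : U}
    (h : T.OpenRealizableAt (e l) (e w) C a b) : F.OpenRealizableAt l w C a b := by
  obtain ⟨W, _, H, φ, d, r, x, hφ, h⟩ := h
  exact ⟨W, _, H, _, d, r, x, hφ.comp_iso e, h⟩

lemma OpenRealizable.subdivide (h : T.OpenRealizable l C a b) (hb : 0 < b) {t : ℤ}
    (ht : 0 < t * b - a) : T.OpenRealizable l C b (t * b - a) := by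
  obtain ⟨W, _, H, φ, w, d, r, x, hφ, h⟩ := h
  obtain ⟨d', r', x', h'⟩ := h.extend hb ht
  obtain ⟨ψ, hψ, hl⟩ := hφ.extend h.leaf
  exact ⟨_, _, _, ψ, _, d', r', x', hψ, by rwa [hl]⟩

/-- The same move as in `OpenRealizable.subdivide`, with the new end now counted as a vertex of the
tree itself. -/
lemma OpenRealizable.addPendant (h : T.OpenRealizable l C a b) (hb : 0 < b) {t : ℤ}
    (ht : 0 < t * b - a) :
    (T.addPendant l).OpenRealizableAt none (some l) C b (t * b - a) := by
  obtain ⟨W, _, H, φ, w, d, r, x, hφ, h⟩ := h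
  obtain ⟨d', r', x', h'⟩ := h.extend hb ht
  exact ⟨_, _, _, _, d', r', x', hφ.addPendant l, h'⟩

lemma OpenRealizableAt.addPendant (h : T.OpenRealizableAt l w C a b) (ha : 0 < a)
    (hab : IsCoprime a b) {β : ℕ} {c : ℤ} (hc : a = β * c) (hb : 0 < b - c) :
    (T.addPendant w).OpenRealizableAt (some l) (some w) (C × ZMod β) a (b - c) := by
  obtain ⟨W, _, H, φ, d, r, x, hφ, h⟩ := h
  obtain ⟨d', r', x', h'⟩ := h.pendant ha hab hc hb
  exact ⟨_, _, _, _, d', r', x', hφ.addPendant w, h'⟩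

lemma OpenRealizable.realizable (h : T.OpenRealizable l C a b) (hab : IsCoprime a b) (hb : 0 < b) :
    T.Realizable C := by
  classical
  induction hn : b.toNat using Nat.strong_induction_on generalizing a b with
  | _ n ih =>
    by_cases hb1 : b = 1
    · subst hb1
      obtain ⟨W, _, H, φ, w, d, r, x, hφ, h⟩ := h
      -- For b = 1 the end relation is the ordinary one with value a at the leaf.
      refine ⟨W, ‹_›, H, φ, Function.update d (φ l) a, r, x, hφ, h.pos, h.primitive, ?_, ?_⟩
      · rw [harmonic_iff_openHarmonic h.leaf, openHarmonic_update_iff, Function.update_self]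
        exact h.harmonic
      · rw [universal_iff_openUniversal h.leaf, Function.update_self]
        exact h.universal.update_end a
    · have h1 := Int.emod_add_mul_ediv a b
      have h2 := Int.emod_lt_of_pos a hb
      have h3 := Int.emod_nonneg a hb.ne'
      have h4 : a % b ≠ 0 := by
        intro h0
        have hu := hab.isUnit_of_dvd' (Int.dvd_of_emod_eq_zero h0) dvd_rfl
        rcases Int.isUnit_iff.1 hu with h' | h' <;> omega
      have h5 : (a / b + 1) * b - a = b - a % b := by linarith
      -- With t the ceiling of a/b, the new second entry b - (a mod b) lies strictly between 0 and
      -- b.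
      have h6 := h.subdivide hb (t := a / b + 1) (by omega)
      refine ih ((a / b + 1) * b - a).toNat (by omega) h6 ?_ (by omega) rfl
      have : IsCoprime b (-a) := hab.symm.neg_right
      have := this.add_mul_left_right (a / b + 1)
      rwa [show -a + b * (a / b + 1) = (a / b + 1) * b - a by ring] at this

lemma Realizable.exists_openRealizable (h : T.Realizable C) (hl : T.IsLeafAt l w) :
    ∃ a : ℤ, 0 < a ∧ T.OpenRealizable l C a 1 := by
  obtain ⟨W, _, H, φ, d, r, x, hφ, hpos, hprim, hr, hx⟩ := h
  obtain ⟨w', hw'⟩ := hφ.exists_isLeafAt hl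
  have hr' := (harmonic_iff_openHarmonic hw').1 hr
  refine ⟨d (φ l), ?_, W, _, H, φ, w', d, r, x, hφ, hw', hpos, hprim, hr',
    (universal_iff_openUniversal hw').1 hx⟩
  have := hr'.eq_end
  rw [one_smul, smul_eq_mul] at this
  exact pos_of_mul_pos_left (this ▸ hpos w') (hpos _).le

/-- One unit at a time: (a, 1) → (a, a + 1) → (a + 1, 1). -/
lemma OpenRealizable.raise (h : T.OpenRealizable l C a 1) (ha : 0 < a) {a' : ℤ} (ha' : a ≤ a') :
    T.OpenRealizable l C a' 1 := by
  induction a', ha' using Int.leInduction with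
  | base => exact h
  | succ n hn ih =>
    have := (ih.shift zero_le_one).subdivide (by omega) (t := 1) (by omega)
    convert this using 1 <;> ring

/-- An `OpenRealizableAt` whose end data `a`, `b` allow it to attach pendant vertices to `w`
that contribute the factor `ZMod β` for any divisor `β` of `N`. -/
def Flexible (T : SimpleGraph V) (l w : V) (N : ℕ) (C : Type) [AddCommGroup C] : Prop :=
  ∃ M b : ℤ, 0 < M ∧ (N : ℤ) ∣ M ∧ 0 < b ∧ M ∣ b - 1 ∧ T.OpenRealizableAt l w C (M * M) b

lemma isCoprime_sq_of_dvd_sub_one {M b : ℤ} (h : M ∣ b - 1) : IsCoprime (M * M) b := by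
  obtain ⟨k, hk⟩ := h
  have : IsCoprime M b := ⟨-k, 1, by linarith⟩
  exact this.mul_left this

lemma Flexible.realizable {N : ℕ} (h : T.Flexible l w N C) : T.Realizable C := by
  obtain ⟨M, b, _, _, hb, hMb, h⟩ := h
  exact h.openRealizable.realizable (isCoprime_sq_of_dvd_sub_one hMb) hb

lemma Flexible.congr_equiv {N : ℕ} (h : T.Flexible l w N C) {C' : Type} [AddCommGroup C']
    (e : C ≃+ C') : T.Flexible l w N C' := by
  obtain ⟨M, b, hM, hN, hb, hMb, h⟩ := h
  exact ⟨M, b, hM, hN, hb, hMb, h.congr_equiv e⟩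

lemma Flexible.comp_iso {N : ℕ} {U : Type u} {F : SimpleGraph U} (e : F ≃g T) {l w : U}
    (h : T.Flexible (e l) (e w) N C) : F.Flexible l w N C := by
  obtain ⟨M, b, hM, hN, hb, hMb, h⟩ := h
  exact ⟨M, b, hM, hN, hb, hMb, h.comp_iso e⟩

lemma Realizable.flexible (h : T.Realizable C) (hl : T.IsLeafAt l w) {N : ℕ} (hN : 0 < N) :
    (T.addPendant l).Flexible none (some l) N C := by
  obtain ⟨a, ha, h⟩ := h.exists_openRealizable hl
  have hN' : (0 : ℤ) < N := by exact_mod_cast hN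
  set M : ℤ := N * (a + 1) with hM
  have hMa : a + 1 ≤ M := by nlinarith
  refine ⟨M, 1, by omega, dvd_mul_right _ _, one_pos, by simp, ?_⟩
  -- The pair then runs (M² - 1, 1) → (M² - 1, M²) → (M², 1), the last arrow attaching the new leaf.
  have h1 := h.raise ha (a' := M * M - 1) (by nlinarith)
  have h2 := (h1.shift zero_le_one).addPendant (t := 1) (by nlinarith) (by linarith)
  convert h2 using 1 <;> ring

/-- With M = βc the move subtracts M²/β = Mc from b, a multiple of M, so b ≡ 1 mod M survives.
Adding M² to b beforehand keeps it positive. -/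
lemma Flexible.addPendant {N : ℕ} (h : T.Flexible l w N C) {β : ℕ} (hβ : β ∣ N) :
    (T.addPendant w).Flexible (some l) (some w) N (C × ZMod β) := by
  obtain ⟨M, b, hM, hN, hb, hMb, h⟩ := h
  obtain ⟨c, hc⟩ : (β : ℤ) ∣ M := (Int.natCast_dvd_natCast.2 hβ).trans hN
  have hMM := mul_pos hM hM
  have hβ0 : 0 < (β : ℤ) := by
    rcases Nat.eq_zero_or_pos β with rfl | h0
    · simp at hc; omega
    · exact_mod_cast h0
  have hc0 : 0 < c := pos_of_mul_pos_right (hc ▸ hM) hβ0.le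
  have hcM : M * c ≤ M * M := by
    refine mul_le_mul_of_nonneg_left ?_ hM.le
    rw [hc]; nlinarith
  have hMb' : M ∣ b + 1 * (M * M) - 1 := by
    rw [show b + 1 * (M * M) - 1 = (b - 1) + M * M by ring]
    exact dvd_add hMb (dvd_mul_right _ _)
  have hpos : 0 < b + 1 * (M * M) - M * c := by linarith
  refine ⟨M, b + 1 * (M * M) - M * c, hM, hN, hpos, ?_,
    (h.shift zero_le_one).addPendant hMM (isCoprime_sq_of_dvd_sub_one hMb') ?_ hpos⟩
  · rw [sub_right_comm]
    exact dvd_sub hMb' (dvd_mul_right _ _)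
  · nth_rewrite 1 [hc]; ring

end realizable

end SimpleGraph

/-! ### Removing leaves from trees. -/

namespace SimpleGraph

section removal

variable {V : Type u} {T : SimpleGraph V} {l w : V}

open Classical in
/-- A graph is recovered by attaching a removed leaf again. -/
noncomputable def IsLeafAt.removeIso (h : T.IsLeafAt l w) :
    T ≃g (T.induce {v | v ≠ l}).addPendant ⟨w, h.ne.symm⟩ where
  toEquiv := (Equiv.optionSubtypeNe l).symm
  map_rel_iff' := by
    intro a b
    obtain ⟨a, rfl⟩ := (Equiv.optionSubtypeNe l).surjective a
    obtain ⟨b, rfl⟩ := (Equiv.optionSubtypeNe l).surjective b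
    rw [Equiv.symm_apply_apply, Equiv.symm_apply_apply]
    rcases a with _ | ⟨a, ha⟩ <;> rcases b with _ | ⟨b, hb⟩
    · simp
    · simp [h b]
    · simp [h.adj_iff a]
    · simp

open Classical in
lemma IsLeafAt.removeIso_self (h : T.IsLeafAt l w) : h.removeIso l = none :=
  (Equiv.optionSubtypeNe l).symm_apply_eq.2 (by simp)

open Classical in
lemma IsLeafAt.removeIso_of_ne (h : T.IsLeafAt l w) {v : V} (hv : v ≠ l) :
    h.removeIso v = some ⟨v, hv⟩ :=
  (Equiv.optionSubtypeNe l).symm_apply_eq.2 (by simp)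

lemma IsTree.remove_leaf (hT : T.IsTree) (h : T.IsLeafAt l w) : (T.induce {v | v ≠ l}).IsTree := by
  classical
  have hn : T.neighborSet l = {w} := Set.ext fun v => h v
  have : Fintype (T.neighborSet l) := by rw [hn]; infer_instance
  refine ⟨hT.connected.induce_compl_singleton_of_degree_eq_one (v := l) ?_, hT.isAcyclic.induce _⟩
  exact degree_eq_one_iff_existsUnique_adj.2 ⟨w, h.adj, fun v hv => (h v).1 hv⟩

/-- The set of vertices of degree one. -/
def leafSet (T : SimpleGraph V) : Set V := {v | ∃ w, T.IsLeafAt v w}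

lemma card_remove [Finite V] (l : V) : Nat.card ({v | v ≠ l} : Set V) + 1 = Nat.card V := by
  classical
  rw [← Finite.card_option]
  exact Nat.card_congr (Equiv.optionSubtypeNe l)

lemma IsLeafAt.of_remove {y z : V} (hyl : y ≠ l) (hzl : z ≠ l) (hy : T.IsLeafAt y z) :
    (T.induce {v | v ≠ l}).IsLeafAt ⟨y, hyl⟩ ⟨z, hzl⟩ := by
  rintro ⟨v, hv⟩
  simp [hy v]

/-- Only `w` loses a neighbour, and it is not a leaf; hence every leaf other than `l` remains one.
-/
lemma ncard_leafSet_le_add_one [Finite V] (hT : T.IsLeafAt l w) {a b : V} (hab : a ≠ b)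
    (ha : T.Adj w a) (hb : T.Adj w b) :
    T.leafSet.ncard ≤ (T.induce {v | v ≠ l}).leafSet.ncard + 1 := by
  have hsub : T.leafSet ⊆ insert l (Subtype.val '' (T.induce {v | v ≠ l}).leafSet) := by
    rintro y ⟨z, hz⟩
    by_cases hy : y = l
    · exact Or.inl hy
    refine Or.inr ⟨⟨y, hy⟩, ⟨⟨z, ?_⟩, hz.of_remove hy ?_⟩, rfl⟩ <;>
    · rintro rfl
      obtain rfl := (hT y).1 hz.adj.symm
      exact hab (((hz a).1 ha).trans ((hz b).1 hb).symm)
  refine (Set.ncard_le_ncard hsub (Set.toFinite _)).trans ((Set.ncard_insert_le _ _).trans ?_)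
  rw [Set.ncard_image_of_injective _ Subtype.val_injective]

/-- Here `w` has degree two and takes the place of `l` as a leaf. -/
lemma ncard_leafSet_le [Finite V] (hT : T.IsLeafAt l w) {v : V} (hvl : v ≠ l) (hv : T.Adj w v)
    (h : ∀ x, T.Adj w x → x = l ∨ x = v) :
    T.leafSet.ncard ≤ (T.induce {v | v ≠ l}).leafSet.ncard := by
  have hwleaf : ⟨w, hT.ne.symm⟩ ∈ (T.induce {v | v ≠ l}).leafSet := by
    refine ⟨⟨v, hvl⟩, ?_⟩
    rintro ⟨x, hx⟩
    simp only [comap_adj, Function.Embedding.subtype_apply, Subtype.mk.injEq]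
    exact ⟨fun hx' => (h x hx').resolve_left hx, fun e => e ▸ hv⟩
  have hsub : T.leafSet ⊆ insert l (Subtype.val '' ((T.induce {v | v ≠ l}).leafSet \
      {⟨w, hT.ne.symm⟩})) := by
    rintro y ⟨z, hz⟩
    by_cases hy : y = l
    · exact Or.inl hy
    have hyw : y ≠ w := by
      rintro rfl
      exact hvl (((hz v).1 hv).trans ((hz l).1 hT.adj.symm).symm)
    refine Or.inr ⟨⟨y, hy⟩, ⟨⟨⟨z, ?_⟩, hz.of_remove hy ?_⟩, by simpa using hyw⟩, rfl⟩ <;>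
    · rintro rfl
      exact hyw ((hT y).1 hz.adj.symm)
  refine (Set.ncard_le_ncard hsub (Set.toFinite _)).trans ((Set.ncard_insert_le _ _).trans ?_)
  rw [Set.ncard_image_of_injective _ Subtype.val_injective,
    Set.ncard_sdiff_singleton_add_one hwleaf (Set.toFinite _)]

end removal

section longestPath

variable {V : Type u} {T : SimpleGraph V}

lemma IsAcyclic.isLeafAt_of_longest (hT : T.IsAcyclic) {u v : V} {p : T.Walk u v} (hp : p.IsPath)
    (hnil : ¬ p.Nil)
    (hmax : ∀ (u' v' : V) (p' : T.Walk u' v'), p'.IsPath → p'.length ≤ p.length) :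
    T.IsLeafAt u p.snd := by
  refine fun y => ⟨fun hy => ?_, fun hy => hy ▸ p.adj_snd hnil⟩
  by_cases hs : y ∈ p.support
  · exact hT.eq_snd_of_adj_start hp hy hs
  · have := hmax _ _ _ (hp.cons (h := hy.symm) hs)
    simp at this

/-- A finite tree with at least three vertices has a leaf whose neighbour `w` has at most one
neighbour `v` that is not a leaf. -/
lemma IsTree.exists_isLeafAt_forall [Finite V] (hT : T.IsTree) (hV : 3 ≤ Nat.card V) :
    ∃ l w v, T.IsLeafAt l w ∧ v ≠ l ∧ T.Adj w v ∧ ∀ x, T.Adj w x → x ≠ v → T.IsLeafAt x w := by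
  classical
  have := hT.connected.nonempty
  have : Nontrivial V := Finite.one_lt_card_iff_nontrivial.1 (by omega)
  obtain ⟨u, t, p, hp, hmax⟩ := Walk.exists_isPath_forall_isPath_length_le_length T
  have hnil : ¬ p.Nil := by
    obtain ⟨a, b, hab⟩ := exists_pair_ne V
    obtain ⟨c, hc⟩ := hT.connected.preconnected.exists_adj_of_nontrivial a
    have := hmax _ _ hc.toWalk (by simp [hc.ne])
    intro h
    rw [← Walk.length_eq_zero_iff] at h
    simp at this
    omega
  have hl := hT.isAcyclic.isLeafAt_of_longest hp hnil hmax
  set w := p.snd with hw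
  -- Replacing the first vertex of the longest path by `x` gives another longest path, so `x` is a
  -- leaf.
  have hleaf : ∀ x, T.Adj w x → x ≠ p.tail.snd → T.IsLeafAt x w := by
    intro x hx hne
    have hxs : x ∉ p.tail.support := fun hs =>
      hne (hT.isAcyclic.eq_snd_of_adj_start hp.tail hx hs)
    have hq := hp.tail.cons (h := hx.symm) hxs
    have := hT.isAcyclic.isLeafAt_of_longest hq (by simp) (fun u' v' p' hp' => by
      rw [Walk.length_cons, Walk.length_tail_add_one hnil]; exact hmax u' v' p' hp')
    simpa using this
  obtain ⟨v, hvu, hwv⟩ : ∃ v, v ≠ u ∧ T.Adj w v := by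
    by_contra! hcon
    have hcl : ∀ a b, T.Reachable a b → a ∈ ({u, w} : Set V) → b ∈ ({u, w} : Set V) := by
      rintro a b ⟨q⟩
      induction q with
      | nil => exact id
      | cons h q ih =>
        refine fun ha => ih ?_
        rcases ha with rfl | ha
        · exact Or.inr ((hl _).1 h)
        · obtain rfl : _ = w := ha
          by_contra hb
          exact hcon _ (fun e => hb (Or.inl e)) h
    have huniv : (Set.univ : Set V) ⊆ {u, w} := fun b _ =>
      hcl u b (hT.connected.preconnected u b) (Or.inl rfl)
    have := Set.ncard_le_ncard huniv (Set.toFinite _)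
    rw [Set.ncard_univ] at this
    have := Set.ncard_insert_le u {w}
    rw [Set.ncard_singleton] at this
    omega
  -- If the tail is a single vertex, `p.tail.snd` defaults to `w` and is no neighbour; any other
  -- neighbour `v` then serves.
  by_cases h0 : p.tail.snd ≠ u ∧ T.Adj w p.tail.snd
  · exact ⟨u, w, _, hl, h0.1, h0.2, hleaf⟩
  · refine ⟨u, w, v, hl, hvu, hwv, fun x hx hxv => ?_⟩
    by_cases hx' : x = p.tail.snd
    · have hxu : x = u := by
        by_contra hne
        exact h0 (hx' ▸ ⟨hne, hx⟩)
      exact hxu ▸ hl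
    · exact hleaf x hx hx'

end longestPath

end SimpleGraph

/-! ### The induction on the tree. -/

namespace SimpleGraph

/-- Splitting off the first factor of a product of cyclic groups. -/
def prodZModConsEquiv {k : ℕ} (β : Fin (k + 1) → ℕ) :
    (ℤ × ((i : Fin k) → ZMod (β i.succ))) × ZMod (β 0) ≃+ ℤ × ((i : Fin (k + 1)) → ZMod (β i)) :=
  AddEquiv.prodAssoc.trans ((AddEquiv.refl ℤ).prodCongr
    (AddEquiv.prodComm.trans (Fin.consLinearEquiv ℤ fun i => ZMod (β i)).toAddEquiv))

section realization

variable {V : Type u} {T : SimpleGraph V}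

/-- On a single edge take d = r = 1: the relations identify the two generators, leaving ℤ. -/
lemma realizable_of_card_eq_two [Finite V] (hT : T.IsTree) (hV : Nat.card V = 2) (A : Type)
    [AddCommGroup A] [Subsingleton A] : T.Realizable (ℤ × A) := by
  classical
  have := Fintype.ofFinite V
  have : Nontrivial V := Finite.one_lt_card_iff_nontrivial.1 (by omega)
  obtain ⟨l⟩ := hT.connected.nonempty
  obtain ⟨w, hw⟩ := hT.connected.preconnected.exists_adj_of_nontrivial l
  have hall : ∀ v, v = l ∨ v = w := by
    obtain ⟨a, b, -, hab⟩ := Nat.card_eq_two_iff.1 hV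
    have h : ∀ v : V, v = a ∨ v = b := fun v => by
      have : v ∈ ({a, b} : Set V) := hab ▸ Set.mem_univ v
      simpa using this
    intro v
    have := hw.ne
    have := h l
    have := h w
    have := h v
    clear h hab
    grind
  have hl : T.IsLeafAt l w := fun v => by
    rcases hall v with rfl | rfl <;> simp [hw, hw.ne]
  have hw' : T.IsLeafAt w l := fun v => by
    rcases hall v with rfl | rfl <;> simp [hw.symm, hw.ne.symm]
  have key : ∀ {D : Type u} [AddCommGroup D] (y : V → D), T.Harmonic 1 y → ∀ v, y v = y l := by
    intro D _ y hy v
    rcases hall v with rfl | rfl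
    · rfl
    · simpa [nbrSum_leaf T hw'] using hy v
  have hconst : ∀ {D : Type} [AddCommGroup D] (c : D), T.Harmonic 1 (fun _ => c) := by
    intro D _ c v
    rcases hall v with rfl | rfl
    · simp [nbrSum_leaf T hl]
    · simp [nbrSum_leaf T hw']
  refine ⟨V, _, T, _, 1, fun _ => 1, fun _ => (1, 0), .of_iso (Iso.refl), by simp, fun g hg =>
    isUnit_of_dvd_one (hg l), hconst _, hconst _, ?_, fun D _ y hy => ?_⟩
  · rw [eq_top_iff]
    rintro ⟨n, m⟩ -
    have h1 : ((1, 0) : ℤ × A) ∈ AddSubgroup.closure (Set.range fun _ : V => ((1, 0) : ℤ × A)) :=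
      AddSubgroup.subset_closure ⟨l, rfl⟩
    have := zsmul_mem h1 n
    rw [Subsingleton.elim m 0]
    simpa using this
  · refine ⟨(zmultiplesHom D (y l)).comp (AddMonoidHom.fst ℤ A), fun v => ?_⟩
    simp [key y hy v]

/-- Both claims are needed at once: flexibility at a given `l`, `w` rests on flexibility at the same
place or on realizability of a smaller tree. The common multiple N is fixed beforehand so that it
serves all factors. -/
lemma realizable_and_flexible {N : ℕ} (hN : 0 < N) (n : ℕ) : ∀ {V : Type u} [Finite V]
    {T : SimpleGraph V}, T.IsTree → Nat.card V = n → ∀ (k : ℕ) (β : Fin k → ℕ), (∀ i, β i ∣ N) →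
    k ≤ T.leafSet.ncard - 2 →
    (2 ≤ n → T.Realizable (ℤ × ((i : Fin k) → ZMod (β i)))) ∧
    ∀ l w v, T.IsLeafAt l w → v ≠ l → T.Adj w v → (∀ x, T.Adj w x → x ≠ v → T.IsLeafAt x w) →
      T.Flexible l w N (ℤ × ((i : Fin k) → ZMod (β i))) := by
  induction n with
  | zero =>
    intro V _ T hT hV
    have := hT.connected.nonempty
    exact absurd hV Nat.card_pos.ne'
  | succ n ih =>
    intro V _ T hT hV k β hβ hk
    have flex : ∀ l w v, T.IsLeafAt l w → v ≠ l → T.Adj w v →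
        (∀ x, T.Adj w x → x ≠ v → T.IsLeafAt x w) →
        T.Flexible l w N (ℤ × ((i : Fin k) → ZMod (β i))) := by
      intro l w v hl hvl hwv hleaf
      by_cases hx : ∃ x, T.Adj w x ∧ x ≠ v ∧ x ≠ l
      · obtain ⟨x, hwx, hxv, hxl⟩ := hx
        have hx := hleaf x hwx hxv
        have hlw := hl.ne
        have hcard := card_remove x
        have hleaves := ncard_leafSet_le_add_one hx hvl hwv hl.adj.symm
        have hflex : ∀ (k' : ℕ) (β' : Fin k' → ℕ), (∀ i, β' i ∣ N) →
            k' ≤ (T.induce {v | v ≠ x}).leafSet.ncard - 2 → ∀ m, m ∣ N →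
            T.Flexible l w N ((ℤ × ((i : Fin k') → ZMod (β' i))) × ZMod m) := by
          intro k' β' hβ' hk' m hm
          have h1 := (ih (hT.remove_leaf hx) (by omega)
            k' β' hβ' hk').2 ⟨l, hxl.symm⟩ ⟨w, hx.ne.symm⟩ ⟨v, hxv.symm⟩
            (hl.of_remove _ _) (by simpa using hvl) hwv ?_
          · have h2 := h1.addPendant hm
            rw [← hx.removeIso_of_ne hxl.symm, ← hx.removeIso_of_ne hx.ne.symm] at h2
            exact h2.comp_iso _
          · rintro ⟨y, hyx⟩ hy hyv
            exact (hleaf y hy (by simpa using hyv)).of_remove _ _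
        cases k with
        | zero =>
          -- With no factor left to place, the leaf is hung back with β = 1, contributing a trivial
          -- group.
          exact (hflex 0 β hβ (Nat.zero_le _) 1 (one_dvd N)).congr_equiv AddEquiv.prodUnique
        | succ k =>
          exact (hflex k (fun i => β i.succ) (fun i => hβ _) (by omega) (β 0) (hβ 0)).congr_equiv
            (prodZModConsEquiv β)
      -- Now `w` has only the neighbours `l` and `v`.
      · push Not at hx
        have hcard := card_remove l
        have hleaves := ncard_leafSet_le hl hvl hwv fun x hx' => by
          by_contra! hne
          exact hne.1 (hx x hx' hne.2)
        have hw : (T.induce {v | v ≠ l}).IsLeafAt ⟨w, hl.ne.symm⟩ ⟨v, hvl⟩ := by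
          rintro ⟨x, hxl⟩
          simp only [comap_adj, Function.Embedding.subtype_apply, Subtype.mk.injEq]
          exact ⟨fun hx' => by_contra fun hne => hxl (hx x hx' hne), fun e => e ▸ hwv⟩
        have h2 : 2 ≤ Nat.card ({v | v ≠ l} : Set V) := by
          have : Nontrivial ({v | v ≠ l} : Set V) :=
            ⟨⟨w, hl.ne.symm⟩, ⟨v, hvl⟩, by simpa using hwv.ne⟩
          exact Finite.one_lt_card_iff_nontrivial.2 this
        have h1 := (ih (hT.remove_leaf hl) (by omega) k β hβ
          (hk.trans (by omega))).1 (by omega)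
        have h3 := h1.flexible hw hN
        rw [← hl.removeIso_self, ← hl.removeIso_of_ne hl.ne.symm] at h3
        exact h3.comp_iso _
    refine ⟨fun hn => ?_, flex⟩
    by_cases hn2 : n + 1 = 2
    · have : T.leafSet.ncard ≤ Nat.card V := by
        rw [← Set.ncard_univ]
        exact Set.ncard_le_ncard (Set.subset_univ _) (Set.toFinite _)
      obtain rfl : k = 0 := by omega
      exact realizable_of_card_eq_two hT (by omega) _
    · obtain ⟨l, w, v, hl, hvl, hwv, hleaf⟩ := hT.exists_isLeafAt_forall (by omega)
      exact (flex l w v hl hvl hwv hleaf).realizable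

end realization

end SimpleGraph

/-! ### From presentations to critical groups. -/

namespace SimpleGraph

/-- The torsion subgroup of a group isomorphic to `ℤ × A`, with `A` finite, is isomorphic to `A`. -/
lemma nonempty_torsion_addEquiv {Q : Type*} [AddCommGroup Q] {A : Type*} [AddCommGroup A]
    [Finite A] (e : Q ≃+ ℤ × A) : Nonempty (Submodule.torsion ℤ Q ≃+ A) := by
  have hmem : ∀ q : Q, q ∈ Submodule.torsion ℤ Q ↔ (e q).1 = 0 := by
    intro q
    rw [Submodule.mem_torsion_iff]
    constructor
    · rintro ⟨c, hc⟩
      have hc' : (c : ℤ) • q = 0 := hc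
      have := congrArg (fun z => (e z).1) hc'
      simpa [nonZeroDivisors.coe_ne_zero c] using this
    · intro hq
      have hcard : (Nat.card A : ℤ) ≠ 0 := by exact_mod_cast Nat.card_pos.ne'
      refine ⟨⟨_, mem_nonZeroDivisors_of_ne_zero hcard⟩, ?_⟩
      change (Nat.card A : ℤ) • q = 0
      apply e.injective
      rw [map_zsmul, map_zero]
      ext
      · simp [hq]
      · simp
  exact ⟨{
    toFun := fun q => (e q).2
    invFun := fun a => ⟨e.symm (0, a), by simp [hmem]⟩
    left_inv := fun q => by
      ext
      rw [AddEquiv.symm_apply_eq]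
      exact Prod.ext ((hmem q).1 q.2).symm rfl
    right_inv := fun a => by simp
    map_add' := fun p q => by simp }⟩

variable {W : Type u} [Fintype W] [DecidableEq W] {H : SimpleGraph W} [DecidableRel H.Adj]

lemma genLaplacian_mulVec_apply (d : W → ℕ) (y : W → ℤ) (v : W) :
    (H.genLaplacian d).mulVec y v = d v * y v - H.nbrSum y v := by
  classical
  simp only [genLaplacian, Matrix.sub_mulVec, Pi.sub_apply, Matrix.mulVec_diagonal,
    adjMatrix_mulVec_apply, nbrSum, neighborFinset_eq_filter, Finset.sum_filter]
  congr!

lemma genLaplacian_mulVec_single (d : W → ℕ) (v : W) :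
    (H.genLaplacian d).mulVec (Pi.single v 1) =
      (d v : ℤ) • Pi.single v 1 - H.nbrSum (fun w => Pi.single w (1 : ℤ)) v := by
  classical
  ext u
  simp only [genLaplacian, Matrix.mulVec_single_one, Matrix.col_apply, Matrix.sub_apply,
    adjMatrix_apply, Pi.sub_apply, Pi.smul_apply, nbrSum, Finset.sum_apply]
  congr 1
  · by_cases h : u = v
    · subst h; simp
    · simp [h]
  · rw [Finset.sum_eq_single u]
    · by_cases h : H.Adj u v <;> simp [h, H.adj_comm v u]
    · intro w _ hw
      by_cases h : H.Adj v w <;> simp [h, hw.symm]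
    · simp

/-- A presentation of `C` by the harmonic relations identifies `C` with the cokernel of the
generalized Laplacian. -/
lemma Universal.nonempty_cokernel_addEquiv {d : W → ℕ} {C : Type} [AddCommGroup C] {x : W → C}
    (h : H.Universal (fun v => (d v : ℤ)) x) :
    Nonempty (((W → ℤ) ⧸ LinearMap.range (H.genLaplacian d).mulVecLin) ≃+ C) := by
  set R := LinearMap.range (H.genLaplacian d).mulVecLin with hR
  let y : W → (W → ℤ) ⧸ R := fun v => R.mkQ (Pi.single v 1)
  have hy : H.Harmonic (fun v => (d v : ℤ)) y := by
    intro v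
    have h1 : R.mkQ ((H.genLaplacian d).mulVec (Pi.single v 1)) = 0 := by
      rw [Submodule.mkQ_apply, Submodule.Quotient.mk_eq_zero]
      exact ⟨_, rfl⟩
    rw [genLaplacian_mulVec_single, map_sub, map_smul, sub_eq_zero] at h1
    rw [h1]
    exact map_nbrSum H R.mkQ.toAddMonoidHom _ v
  obtain ⟨f, hf⟩ := h.lift _ y hy
  have hker : R ≤ LinearMap.ker (Fintype.linearCombination ℤ x) := by
    rintro _ ⟨z, rfl⟩
    have : (Fintype.linearCombination ℤ x).comp (H.genLaplacian d).mulVecLin = 0 := by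
      apply (Pi.basisFun ℤ W).ext
      intro v
      simp only [Pi.basisFun_apply, LinearMap.comp_apply, Matrix.mulVecLin_apply,
        genLaplacian_mulVec_single, map_sub, map_smul, Fintype.linearCombination_apply_single,
        one_smul, LinearMap.zero_apply]
      rw [h.harmonic v, sub_eq_zero]
      have := map_nbrSum H (Fintype.linearCombination ℤ x).toAddMonoidHom
        (fun w => Pi.single w (1 : ℤ)) v
      simp only [LinearMap.toAddMonoidHom_coe, Fintype.linearCombination_apply_single,
        one_smul] at this
      exact this.symm
    exact LinearMap.congr_fun this z
  let g : ((W → ℤ) ⧸ R) →ₗ[ℤ] C := R.liftQ _ hker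
  have hg : ∀ v, g (y v) = x v := fun v => by
    simp [g, y, Fintype.linearCombination_apply_single]
  refine ⟨AddMonoidHom.toAddEquiv g.toAddMonoidHom f ?_ ?_⟩
  · have : f.toIntLinearMap.comp g = LinearMap.id := by
      apply Submodule.linearMap_qext
      apply (Pi.basisFun ℤ W).ext
      intro v
      have : f (g (y v)) = y v := by rw [hg, hf]
      simpa [y] using this
    ext q
    exact LinearMap.congr_fun this q
  -- Since the family generates `C`, the composite need only be checked on it.
  · refine AddMonoidHom.eq_of_eqOn_dense h.closure_eq ?_
    rintro _ ⟨v, rfl⟩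
    simp [hf, hg]

lemma Realizable.exists_arithmeticalStructure {V : Type u} {T : SimpleGraph V} {A : Type}
    [AddCommGroup A] [Finite A] (h : T.Realizable (ℤ × A)) :
    ∃ (W : Type u) (_ : Fintype W) (_ : DecidableEq W) (T' : SimpleGraph W)
      (_ : DecidableRel T'.Adj) (S : ArithmeticalStructure T'),
      T.IsSubdivision T' ∧ Nonempty (S.CriticalGroup ≃+ A) := by
  classical
  obtain ⟨W, _, H, φ, d, r, x, hφ, hpos, hprim, hr, hx⟩ := h
  -- Nonnegativity of d is automatic: d(v) r(v) is a sum of positive values of r and r(v) > 0.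
  have hd : ∀ v, ((d v).toNat : ℤ) = d v := fun v => by
    refine Int.toNat_of_nonneg ?_
    have h1 : 0 ≤ d v * r v := by
      have := hr v
      rw [smul_eq_mul] at this
      rw [this]
      refine Finset.sum_nonneg fun w _ => ?_
      split_ifs
      exacts [(hpos w).le, le_rfl]
    exact nonneg_of_mul_nonneg_left h1 (hpos v)
  have hrn : ∀ v, ((r v).toNat : ℤ) = r v := fun v => Int.toNat_of_nonneg (hpos v).le
  let S : ArithmeticalStructure H :=
    { d := fun v => (d v).toNat
      r := fun v => (r v).toNat
      r_pos := fun v => by have := hpos v; omega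
      r_gcd := by
        refine Nat.isUnit_iff.1 (Int.ofNat_isUnit.1 (hprim _ fun v => ?_))
        rw [← hrn v]
        exact Int.natCast_dvd_natCast.2 (Finset.gcd_dvd (Finset.mem_univ v))
      laplacian_mulVec := by
        ext v
        rw [genLaplacian_mulVec_apply]
        simp only [hrn, hd]
        rw [← smul_eq_mul, hr v, sub_self, Pi.zero_apply] }
  have hx' : H.Universal (fun v => ((S.d v : ℕ) : ℤ)) x := by
    simpa only [S, hd] using hx
  obtain ⟨e⟩ := hx'.nonempty_cokernel_addEquiv
  exact ⟨W, _, _, H, _, S, hφ.isSubdivision, nonempty_torsion_addEquiv e⟩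

lemma numLeaves_eq_ncard_leafSet {V : Type u} [Fintype V] (T : SimpleGraph V)
    [DecidableRel T.Adj] : T.numLeaves = T.leafSet.ncard := by
  rw [numLeaves, ← Set.ncard_coe_finset]
  congr 1
  ext v
  simp only [Finset.coe_filter, Finset.mem_univ, true_and, Set.mem_ofPred_eq, leafSet,
    degree_eq_one_iff_existsUnique_adj]
  constructor
  · rintro ⟨w, hw, hw'⟩
    exact ⟨w, fun u => ⟨hw' u, fun e => e ▸ hw⟩⟩
  · rintro ⟨w, hw⟩
    exact ⟨w, hw.adj, fun u hu => (hw u).1 hu⟩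

end SimpleGraph

theorem corollary7p3 {V : Type u} [Fintype V] [DecidableEq V] (T : SimpleGraph V)
    [DecidableRel T.Adj] (hT : T.IsTree)
    (A : Type v) [AddCommGroup A] [Finite A]
    (hA : HasAtMostInvariantFactors A ((T.numLeaves : ℤ) - 2)) :
    ∃ (W : Type u) (_ : Fintype W) (_ : DecidableEq W) (T' : SimpleGraph W)
      (_ : DecidableRel T'.Adj) (S : ArithmeticalStructure T'),
      T.IsSubdivision T' ∧ Nonempty (S.CriticalGroup ≃+ A) := by
  obtain ⟨k, α, hk, hα, -, ⟨e⟩⟩ := hA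
  rw [T.numLeaves_eq_ncard_leafSet] at hk
  have hpos : ∀ i, 0 < α i := fun i => zero_lt_one.trans (hα i)
  have hcard : T.leafSet.ncard ≤ Nat.card V := by
    rw [← Set.ncard_univ]
    exact Set.ncard_le_ncard (Set.subset_univ _) (Set.toFinite _)
  have (i : Fin k) : NeZero (α i) := ⟨(hpos i).ne'⟩
  -- The product of all the `α i` serves as N.
  obtain ⟨W, i₁, i₂, T', i₃, S, hS, ⟨f⟩⟩ := ((SimpleGraph.realizable_and_flexible
    (Finset.prod_pos fun i _ => hpos i) (Nat.card V) hT rfl k α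
    (fun i => Finset.dvd_prod_of_mem α (Finset.mem_univ i)) (by omega)).1
    (by omega)).exists_arithmeticalStructure
  exact ⟨W, i₁, i₂, T', i₃, S, hS, ⟨f.trans e.symm⟩⟩
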